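/- The PS machine consists of a pop stack followed by a stack. It takes a permutation $\pi$ of $\{1,\dots,n\}$ as input and may perform, in any order, the following operations: \emph{input}: push the next entry of the input $\pi(1),\pi(2),\dots,\pi(n)$ onto the pop stack; \emph{transfer}: pop the entire pop stack, in last-in first-out order, each popped entry being pushed immediately onto the stack; \emph{output}: pop the top entry of the stack and append it to the output. The permutation $\pi$ is PS-sortable if, starting with both stacks empty, some sequence of operations outputs $1,2,\dots,n$. Theorem. Let $a_n$ be the number of PS-sortable permutations of length $n$. Then, as formal power series over $\mathbb{Q}$, $$\sum_{n\ge 1} a_n x^n=\frac{1-3x+2x^2-\sqrt{1-6x+5x^2}}{2x(2-x)},$$ where $\sqrt{1-6x+5x^2}$ denotes the power series with constant term $1$ whose square is $1-6x+5x^2$. Moreover, $(a_n)_{n\ge1}$ is the sequence A033321 of the OEIS ($1,2,6,21,79,311,\dots$ for $n=1,2,3,\dots$), the binomial transform of Fine's numbers: for all $n\ge 1$, $$a_n=\sum_{k=0}^n\binom nk F_k,$$ where $F_0=1$ and $2F_k+F_{k-1}=C_k=\frac1{k+1}\binom{2k}{k}$ for $k\ge1$. -/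

import Mathlib

/-- A configuration of the machine consisting of a pop stack followed by a stack.
`input` is read from its head; `popStack` and `stack` have their top entry at the head;
`output` is in the order of output (first entry output at the head). -/
structure PSState (α : Type*) where
  input : List α
  popStack : List α
  stack : List α
  output : List α

/-- Push the entries of `l` onto the stack `s` one after another, the head of `l` first. -/
def pushAll {α : Type*} (l s : List α) : List α :=
  l.foldl (fun t a => a :: t) s

/-- The operations of the machine. -/
inductive PSStep {α : Type*} : PSState α → PSState α → Prop
  /-- Move the next input entry onto the pop stack. -/
  | input (a : α) (i p s o : List α) :
      PSStep ⟨a :: i, p, s, o⟩ ⟨i, a :: p, s, o⟩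
  /-- Pop the whole pop stack, last in first out, each entry being pushed immediately
  onto the stack. -/
  | transfer (i p s o : List α) :
      PSStep ⟨i, p, s, o⟩ ⟨i, [], pushAll p s, o⟩
  /-- Pop the top entry of the stack to the output. -/
  | output (a : α) (i p s o : List α) :
      PSStep ⟨i, p, a :: s, o⟩ ⟨i, p, s, o ++ [a]⟩

/-- The permutation `π(0), …, π(n-1)` is sortable if some sequence of operations turns it,
as input to the empty machine, into the increasing output `0, …, n-1`. -/
def PSSortable {n : ℕ} (π : Equiv.Perm (Fin n)) : Prop :=
  Relation.ReflTransGen PSStep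
    (⟨List.ofFn π, [], [], []⟩ : PSState (Fin n)) ⟨[], [], [], List.finRange n⟩

/-- The number of sortable permutations of length `n`. -/
noncomputable def psCount (n : ℕ) : ℕ :=
  Nat.card {π : Equiv.Perm (Fin n) // PSSortable π}

/-- The generating function of the nonempty sortable permutations by length. -/
noncomputable def psGenFun : PowerSeries ℚ :=
  PowerSeries.mk fun n => if n = 0 then 0 else (psCount n : ℚ)

/-- Fine's numbers `1, 0, 1, 2, 6, 18, 57, …`, given by `F 0 = 1` and
`2 * F n + F (n - 1) = catalan n` for `n ≥ 1`. -/
def fineNumber : ℕ → ℚ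
  | 0 => 1
  | n + 1 => ((catalan (n + 1) : ℚ) - fineNumber n) / 2

/-- OEIS sequence A033321 `1, 1, 2, 6, 21, 79, 311, …`: the binomial transform of Fine's
numbers. -/
def oeisA033321 (n : ℕ) : ℚ :=
  ∑ k ∈ Finset.range (n + 1), (n.choose k : ℚ) * fineNumber k

/-! ### A block semantics for the machine -/

/-! Relabelling entries by `π.symm` turns sorting `π` into generating the list of `π.symm` from the
increasing input, so the lists that the machine generates are to be counted. The pop stack and the
transfer reverse a block twice, hence the machine moves consecutive blocks of the input, order
unchanged, to the top of the stack (`BlockGen`).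

Classifying outputs by their first entry gives disjoint cases when entries are distinct, with counts
depending only on lengths. Let H count, by input length, the outputs from an empty stack. A stack of
size h gives H^(h+1). Let L_h count the outputs starting with a later input entry while h entries
are pending or stacked. Then H^(h+1) = H^h + X(H^(h+1) + L_(h+1)) and L_h = X(H^(h+1) + 2L_(h+1)).
These hold for L_h = XH^(h+1)/(1-2XH) when X(2-X)H² - (1+X)H + 1 = 0. The series of A033321
satisfies this quadratic (`mk_oeisA033321_quadratic`), and `hasCard_outputs` matches it with the
counts by induction on the input. -/

/-- `BlockGen i s o`: the input `i` and stack content `s` can be turned into the output `o` by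
moving initial blocks of the input, in their order, to the top of the stack, and outputting
the top of the stack. -/
inductive BlockGen {α : Type*} : List α → List α → List α → Prop
  | done : BlockGen [] [] []
  | out {i s o : List α} (a : α) : BlockGen i s o → BlockGen i (a :: s) (a :: o)
  | block {i s o : List α} (b : List α) : BlockGen i (b ++ s) o → BlockGen (b ++ i) s o

section Semantics

variable {α β : Type*}

theorem pushAll_eq_reverse_append (l s : List α) : pushAll l s = l.reverse ++ s := by
  induction l generalizing s with
  | nil => rfl
  | cons a l ih =>
    change pushAll l (a :: s) = _
    simp [ih]

theorem BlockGen.of_reachable {q : PSState α} {o' : List α}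
    (h : Relation.ReflTransGen PSStep q ⟨[], [], [], o'⟩) :
    ∃ o, o' = q.output ++ o ∧ BlockGen (q.popStack.reverse ++ q.input) q.stack o := by
  induction h using Relation.ReflTransGen.head_induction_on with
  | refl => exact ⟨[], by simp, .done⟩
  | head h _ ih =>
    obtain ⟨o, ho, hg⟩ := ih
    cases h with
    | input a i p s o₁ => exact ⟨o, ho, by simpa using hg⟩
    | transfer i p s o₁ =>
      refine ⟨o, ho, .block _ ?_⟩
      simpa [pushAll_eq_reverse_append] using hg
    | output a i p s o₁ => exact ⟨a :: o, by simpa using ho, .out a hg⟩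

theorem PSStep.reachable_input (b i p s o : List α) :
    Relation.ReflTransGen PSStep ⟨b ++ i, p, s, o⟩ ⟨i, b.reverse ++ p, s, o⟩ := by
  induction b generalizing p with
  | nil => exact .refl
  | cons a b ih =>
    refine .head (PSStep.input a (b ++ i) p s o) ?_
    simpa using ih (a :: p)

theorem BlockGen.reachable {i s o : List α} (h : BlockGen i s o) (o₁ : List α) :
    Relation.ReflTransGen PSStep ⟨i, [], s, o₁⟩ ⟨[], [], [], o₁ ++ o⟩ := by
  induction h generalizing o₁ with
  | done => simpa using Relation.ReflTransGen.refl
  | out a _ ih =>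
    refine .head (PSStep.output a _ _ _ _) ?_
    simpa using ih (o₁ ++ [a])
  | block b _ ih =>
    refine (PSStep.reachable_input b _ [] _ o₁).trans (.head (PSStep.transfer _ _ _ _) ?_)
    simpa [pushAll_eq_reverse_append] using ih o₁

theorem reachable_iff_blockGen {i o : List α} :
    Relation.ReflTransGen PSStep ⟨i, [], [], []⟩ ⟨[], [], [], o⟩ ↔ BlockGen i [] o := by
  refine ⟨fun h => ?_, fun h => by simpa using h.reachable []⟩
  obtain ⟨o', rfl, h'⟩ := BlockGen.of_reachable h
  simpa using h'

theorem BlockGen.map (f : α → β) {i s o : List α} (h : BlockGen i s o) :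
    BlockGen (i.map f) (s.map f) (o.map f) := by
  induction h with
  | done => exact .done
  | out a _ ih => exact .out (f a) ih
  | block b _ ih =>
    rw [List.map_append] at ih ⊢
    exact .block _ ih

theorem BlockGen.perm {i s o : List α} (h : BlockGen i s o) : o.Perm (i ++ s) := by
  induction h with
  | done => exact .refl _
  | @out i s o a _ ih => exact (ih.cons a).trans List.perm_middle.symm
  | @block i s o b _ ih =>
    refine ih.trans ?_
    rw [← List.append_assoc]
    exact List.perm_append_comm.append_right s

/-- Later blocks only land above the stack, so its entries leave in their order from the top. -/
theorem BlockGen.stack_sublist {i s o : List α} (h : BlockGen i s o) : s.Sublist o := by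
  induction h with
  | done => exact .refl _
  | out a _ ih => exact ih.cons_cons a
  | block b _ ih => exact (List.sublist_append_right b _).trans ih

/-! ### Decomposition by the first output entry -/

/-- The outputs from input `i`, a block `b` that has been read but may still be extended, and
stack `s`, whose first entry comes from `i`. -/
def lateOutputs : List α → List α → List α → Set (List α)
  | [], _, _ => ∅
  | x :: i, b, s => List.cons x '' {o | BlockGen i (b ++ s) o} ∪
      (lateOutputs i (b ++ [x]) s ∪ lateOutputs i [x] (b ++ s))

theorem lateOutputs_append {i b c s o : List α} (h : o ∈ lateOutputs i (b ++ c) s) :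
    o ∈ lateOutputs (c ++ i) b s := by
  induction c generalizing b with
  | nil => simpa using h
  | cons x c ih => exact Or.inr (Or.inl (ih (by simpa using h)))

theorem BlockGen.of_mem_lateOutputs {i b s o : List α} (h : o ∈ lateOutputs i b s) :
    BlockGen (b ++ i) s o := by
  induction i generalizing b s with
  | nil => exact h.elim
  | cons x i ih =>
    rcases h with ⟨o, h, rfl⟩ | h | h
    · exact .block b (.block [x] (.out x h))
    · simpa using ih h
    · exact .block b (ih h)

theorem head_mem_of_mem_lateOutputs {i b s o : List α} (h : o ∈ lateOutputs i b s) :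
    ∃ x ∈ i, ∃ o', o = x :: o' := by
  induction i generalizing b s with
  | nil => exact h.elim
  | cons y i ih =>
    rcases h with ⟨o, h, rfl⟩ | h | h
    · exact ⟨y, by simp, o, rfl⟩
    · obtain ⟨x, hx, h⟩ := ih h
      exact ⟨x, by simp [hx], h⟩
    · obtain ⟨x, hx, h⟩ := ih h
      exact ⟨x, by simp [hx], h⟩

theorem sublist_of_mem_lateOutputs {i b s o : List α} (h : o ∈ lateOutputs i b s) :
    (b ++ s).Sublist o := by
  induction i generalizing b s with
  | nil => exact h.elim
  | cons x i ih =>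
    rcases h with ⟨o, h, rfl⟩ | h | h
    · exact h.stack_sublist.cons x
    · refine List.Sublist.trans ?_ (ih h)
      simp
    · exact (List.sublist_append_right [x] _).trans (ih h)

/-- The outputs from input `i` and stack `s` whose first entry comes from `i`. -/
def inputFirstOutputs : List α → List α → Set (List α)
  | [], _ => ∅
  | x :: i, s => List.cons x '' {o | BlockGen i s o} ∪ lateOutputs i [x] s

/-- The outputs from input `i` and stack `s` whose first entry is the top of `s`. -/
def stackFirstOutputs : List α → List α → Set (List α)
  | _, [] => ∅
  | i, a :: s => List.cons a '' {o | BlockGen i s o}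

theorem BlockGen.of_mem_inputFirstOutputs {i s o : List α} (h : o ∈ inputFirstOutputs i s) :
    BlockGen i s o := by
  cases i with
  | nil => exact h.elim
  | cons x i =>
    rcases h with ⟨o, h, rfl⟩ | h
    · exact .block [x] (.out x h)
    · exact .of_mem_lateOutputs h

theorem BlockGen.of_mem_stackFirstOutputs {i s o : List α} (h : o ∈ stackFirstOutputs i s) :
    BlockGen i s o := by
  cases s with
  | nil => exact h.elim
  | cons a s =>
    obtain ⟨o, h, rfl⟩ := h
    exact .out a h

theorem BlockGen.first_cases {i s o : List α} (h : BlockGen i s o) :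
    (i = [] ∧ s = [] ∧ o = []) ∨ o ∈ stackFirstOutputs i s ∨ o ∈ inputFirstOutputs i s := by
  induction h with
  | done => simp
  | out a h _ => exact Or.inr (Or.inl ⟨_, h, rfl⟩)
  | @block i s o b h ih =>
    cases b with
    | nil => exact ih
    | cons y b =>
      refine Or.inr (Or.inr ?_)
      rcases ih with ⟨_, h, _⟩ | h | h
      · simp at h
      · obtain ⟨o', h', rfl⟩ := h
        -- If the top `y` of the block leaves first, the rest of the block can be transferred
        -- afterwards.
        exact Or.inl ⟨o', .block b h', rfl⟩
      · refine Or.inr (lateOutputs_append ?_)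
        cases i with
        | nil => exact h.elim
        | cons x i =>
          rcases h with h | h
          · exact Or.inl h
          · exact Or.inr (Or.inr h)

theorem setOf_blockGen_nil : {o : List α | BlockGen [] [] o} = {[]} := by
  ext o
  refine ⟨fun h => ?_, fun h => ?_⟩
  · exact List.perm_nil.1 (by simpa using h.perm)
  · rw [Set.mem_singleton_iff.1 h]
    exact .done

theorem setOf_blockGen_eq_union {i s : List α} (h : i ≠ [] ∨ s ≠ []) :
    {o | BlockGen i s o} = stackFirstOutputs i s ∪ inputFirstOutputs i s := by
  ext o
  refine ⟨fun ho => ?_, fun ho => ?_⟩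
  · rcases BlockGen.first_cases ho with ⟨hi, hs, _⟩ | ho
    · simp [hi, hs] at h
    · exact ho
  · exact ho.elim .of_mem_stackFirstOutputs .of_mem_inputFirstOutputs

theorem head_mem_of_mem_inputFirstOutputs {i s o : List α} (h : o ∈ inputFirstOutputs i s) :
    ∃ x ∈ i, ∃ o', o = x :: o' := by
  cases i with
  | nil => exact h.elim
  | cons y i =>
    rcases h with ⟨o, h, rfl⟩ | h
    · exact ⟨y, by simp, o, rfl⟩
    · obtain ⟨x, hx, h⟩ := head_mem_of_mem_lateOutputs h
      exact ⟨x, by simp [hx], h⟩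

theorem disjoint_stackFirstOutputs_inputFirstOutputs {i s : List α} (h : (i ++ s).Nodup) :
    Disjoint (stackFirstOutputs i s) (inputFirstOutputs i s) := by
  refine Set.disjoint_left.2 fun o h₁ h₂ => ?_
  obtain ⟨x, hx, o', rfl⟩ := head_mem_of_mem_inputFirstOutputs h₂
  cases s with
  | nil => exact h₁.elim
  | cons a s =>
    obtain ⟨o, _, ho⟩ := h₁
    obtain ⟨rfl, rfl⟩ := List.cons.inj ho
    exact (List.nodup_append.1 h).2.2 a hx a (by simp) rfl

theorem disjoint_cons_lateOutputs {x : α} {i b s : List α} {t : Set (List α)}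
    (h : x ∉ i) : Disjoint (List.cons x '' t) (lateOutputs i b s) := by
  refine Set.disjoint_left.2 fun o h₁ h₂ => ?_
  obtain ⟨y, hy, o', rfl⟩ := head_mem_of_mem_lateOutputs h₂
  obtain ⟨o, _, ho⟩ := h₁
  obtain ⟨rfl, rfl⟩ := List.cons.inj ho
  exact h hy

theorem List.Nodup.not_pair_sublist_swap {a b : α} {l : List α} (hl : l.Nodup)
    (h₁ : [a, b].Sublist l) : ¬ [b, a].Sublist l := by
  intro h₂
  induction l with
  | nil => simp at h₁
  | cons y l ih =>
    obtain ⟨hy, hl⟩ := List.nodup_cons.1 hl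
    cases h₁ with
    | cons _ h₁ =>
      cases h₂ with
      | cons _ h₂ => exact ih hl h₁ h₂
      | cons_cons _ h₂ => exact hy (h₁.subset (by simp))
    | cons_cons _ h₁ =>
      cases h₂ with
      | cons _ h₂ => exact hy (h₂.subset (by simp))
      | cons_cons _ h₂ => exact hy (h₁.subset (by simp))

/-- If `x` joins the pending block, the head of `b` leaves before `x`; if `x` starts a new block, it
lies above `b` and leaves earlier. An empty `b` would make both cases coincide. -/
theorem disjoint_lateOutputs_lateOutputs {x : α} {i b s : List α} (hb : b ≠ [])
    (h : (i ++ (x :: b ++ s)).Nodup) :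
    Disjoint (lateOutputs i (b ++ [x]) s) (lateOutputs i [x] (b ++ s)) := by
  refine Set.disjoint_left.2 fun o h₁ h₂ => ?_
  have hp := (BlockGen.of_mem_lateOutputs h₂).perm
  have hn : o.Nodup := hp.nodup_iff.2
    ((List.perm_append_comm.append_right (b ++ s)).nodup_iff.1 (by simpa using h))
  obtain ⟨c, b, rfl⟩ := List.exists_cons_of_ne_nil hb
  have h₁ : [c, x].Sublist o := by
    refine List.Sublist.trans ?_ (sublist_of_mem_lateOutputs h₁)
    simp
  have h₂ : [x, c].Sublist o := by
    refine List.Sublist.trans ?_ (sublist_of_mem_lateOutputs h₂)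
    simp
  exact hn.not_pair_sublist_swap h₁ h₂

end Semantics

/-! ### The power series of the sequence A033321 -/

section Series

open PowerSeries

theorem two_add_X_mul_mk_fineNumber :
    (2 + X) * (mk fineNumber : PowerSeries ℚ) = map (Nat.castRingHom ℚ) catalanSeries + 1 := by
  ext n
  have h2 : (2 : PowerSeries ℚ) = C 2 := rfl
  cases n with
  | zero =>
    simp [add_mul, fineNumber, h2, -coeff_zero_eq_constantCoeff]
    norm_num
  | succ n =>
    simp only [add_mul, h2, map_add, coeff_C_mul, coeff_mk, coeff_succ_X_mul, coeff_map,
      catalanSeries_coeff, coeff_one, fineNumber]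
    simp
    ring

theorem mk_fineNumber_quadratic :
    X * (2 + X) * (mk fineNumber : PowerSeries ℚ) ^ 2 - (1 + 2 * X) * mk fineNumber + 1 = 0 := by
  have h := two_add_X_mul_mk_fineNumber
  have hc := congrArg (map (Nat.castRingHom ℚ)) catalanSeries_sq_mul_X_add_one
  simp only [map_add, map_mul, map_pow, map_one, map_X] at hc
  have hne : (2 + X : PowerSeries ℚ) ≠ 0 := fun h0 => by
    have := congrArg constantCoeff h0
    rw [map_add, map_ofNat, constantCoeff_X, map_zero] at this
    norm_num at this
  -- Substituting c = (2 + X)F - 1 into c = 1 + Xc² yields the claim times 2 + X.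
  refine mul_left_cancel₀ hne ?_
  set F : PowerSeries ℚ := mk fineNumber
  set c := map (Nat.castRingHom ℚ) catalanSeries
  have hc' : c = (2 + X) * F - 1 := by rw [h]; ring
  rw [hc'] at hc
  linear_combination hc

/-- The power series `x + x ^ 2 + ⋯ = x / (1 - x)`. -/
noncomputable def geomX : PowerSeries ℚ := X * mk 1

theorem hasSubst_geomX : HasSubst geomX :=
  HasSubst.of_constantCoeff_zero' (by simp [geomX])

theorem coeff_succ_geomX_pow_succ (n k : ℕ) :
    coeff (n + 1) (geomX ^ (k + 1)) = (n.choose k : ℚ) := by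
  rw [geomX, mul_pow, mk_one_pow_eq_mk_choose_add, coeff_X_pow_mul']
  split_ifs with h
  · have : k ≤ n := by omega
    rw [coeff_mk, show n + 1 - (k + 1) = n - k by omega, Nat.add_sub_cancel' this]
  · rw [Nat.choose_eq_zero_of_lt (by omega), Nat.cast_zero]

theorem one_sub_X_mul_mk_oeisA033321 :
    (1 - X) * mk oeisA033321 = (mk fineNumber : PowerSeries ℚ).subst geomX := by
  ext n
  rw [coeff_subst' hasSubst_geomX]
  cases n with
  | zero =>
    rw [finsum_eq_single _ 0 fun k hk => by
      simp [geomX, hk]]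
    simp [oeisA033321, fineNumber]
  | succ n =>
    rw [finsum_eq_sum_of_support_subset (s := Finset.range (n + 2))]
    -- The sum for `n` gets one extra zero term, so that Pascal's rule applies termwise to the
    -- difference of consecutive coefficients.
    · have hn : oeisA033321 n = ∑ k ∈ Finset.range (n + 2), (n.choose k : ℚ) * fineNumber k := by
        rw [Finset.sum_range_succ, Nat.choose_succ_self, oeisA033321]
        simp
      rw [sub_mul, one_mul, map_sub, coeff_succ_X_mul, coeff_mk, coeff_mk, hn, oeisA033321,
        ← Finset.sum_sub_distrib, Finset.sum_range_succ' _ (n + 1),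
        Finset.sum_range_succ' _ (n + 1)]
      simp only [coeff_succ_geomX_pow_succ, coeff_mk, Nat.choose_succ_succ, Nat.cast_add,
        smul_eq_mul]
      simp only [add_mul]
      simp [coeff_one, mul_comm]
    · intro k hk
      by_contra hk'
      simp only [Finset.coe_range, Set.mem_Iio, not_lt] at hk'
      obtain ⟨k, rfl⟩ : ∃ j, k = j + 1 := ⟨k - 1, by omega⟩
      rw [Function.mem_support, coeff_succ_geomX_pow_succ,
        Nat.choose_eq_zero_of_lt (by omega)] at hk
      simp at hk

theorem mk_oeisA033321_quadratic :
    X * (2 - X) * (mk oeisA033321 : PowerSeries ℚ) ^ 2 - (1 + X) * mk oeisA033321 + 1 = 0 := by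
  have h := congrArg (substAlgHom hasSubst_geomX) mk_fineNumber_quadratic
  simp only [map_add, map_sub, map_mul, map_pow, map_one, map_zero, map_ofNat,
    substAlgHom_X] at h
  rw [coe_substAlgHom, ← one_sub_X_mul_mk_oeisA033321] at h
  have hu : (mk 1 : PowerSeries ℚ) * (1 - X) = 1 := mk_one_mul_one_sub_eq_one ℚ
  have hg : geomX * (1 - X) = X := by rw [geomX, mul_assoc, hu, mul_one]
  set H : PowerSeries ℚ := mk oeisA033321
  linear_combination h + (-(2 * H ^ 2 * (1 - X)) - H ^ 2 * (geomX * (1 - X) + X) + 2 * H) * hg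

end Series

/-! ### Counting outputs -/

/-- The set `s` is finite with `q` elements. -/
def HasCard {α : Type*} (s : Set α) (q : ℚ) : Prop :=
  s.Finite ∧ (s.ncard : ℚ) = q

section Counting

open PowerSeries

variable {α : Type*}

theorem HasCard.empty : HasCard (∅ : Set α) 0 := by
  simp [HasCard]

theorem HasCard.union {s t : Set α} {p q : ℚ} (hs : HasCard s p) (ht : HasCard t q)
    (h : Disjoint s t) : HasCard (s ∪ t) (p + q) := by
  refine ⟨hs.1.union ht.1, ?_⟩
  rw [Set.ncard_union_eq h hs.1 ht.1, Nat.cast_add, hs.2, ht.2]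

theorem HasCard.image_cons {s : Set (List α)} {q : ℚ} (hs : HasCard s q) (a : α) :
    HasCard (List.cons a '' s) q := by
  refine ⟨hs.1.image _, ?_⟩
  rw [Set.ncard_image_of_injective _ (List.cons_injective), hs.2]

/-! ### Recurrences for the counting series -/

/-- The generating function of A033321. -/
noncomputable def outputSeries : PowerSeries ℚ := mk oeisA033321

/-- The generating function, by length of the remaining input, of the outputs that start
with an input entry, given a pending block and a stack of total size `h`. -/
noncomputable def lateSeries (h : ℕ) : PowerSeries ℚ :=
  X * outputSeries ^ (h + 1) * (1 - 2 * X * outputSeries)⁻¹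

theorem one_sub_mul_inv_cancel :
    (1 - 2 * X * outputSeries) * (1 - 2 * X * outputSeries)⁻¹ = 1 :=
  PowerSeries.mul_inv_cancel _ (by simp)

theorem lateSeries_eq (h : ℕ) :
    lateSeries h = X * (outputSeries ^ (h + 1) + lateSeries (h + 1) + lateSeries (h + 1)) := by
  unfold lateSeries
  linear_combination X * outputSeries ^ (h + 1) * one_sub_mul_inv_cancel

/-- Multiplied by 1 - 2XH, the equation becomes H^h times the quadratic for H. -/
theorem outputSeries_pow_succ (h : ℕ) :
    outputSeries ^ (h + 1) =
      outputSeries ^ h + X * (outputSeries ^ (h + 1) + lateSeries (h + 1)) := by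
  have hq : X * (2 - X) * outputSeries ^ 2 - (1 + X) * outputSeries + 1 = 0 :=
    mk_oeisA033321_quadratic
  unfold lateSeries
  linear_combination (-outputSeries ^ h * (1 - 2 * X * outputSeries)⁻¹) * hq +
    (outputSeries ^ h - outputSeries ^ (h + 1) + X * outputSeries ^ (h + 1)) *
      one_sub_mul_inv_cancel

theorem coeff_zero_lateSeries (h : ℕ) : coeff 0 (lateSeries h) = 0 := by
  rw [lateSeries_eq, coeff_zero_X_mul]

theorem coeff_zero_outputSeries_pow (h : ℕ) : coeff 0 (outputSeries ^ h) = 1 := by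
  simp [outputSeries, oeisA033321, fineNumber]

theorem hasCard_lateOutputs_cons {x : α} {i b s : List α} (hb : b ≠ [])
    (hn : (x :: i ++ (b ++ s)).Nodup)
    (hgen : ∀ t : List α, (i ++ t).Nodup →
      HasCard {o | BlockGen i t o} (coeff i.length (outputSeries ^ (t.length + 1))))
    (hlate : ∀ b s : List α, b ≠ [] → (i ++ (b ++ s)).Nodup →
      HasCard (lateOutputs i b s) (coeff i.length (lateSeries (b.length + s.length)))) :
    HasCard (lateOutputs (x :: i) b s)
      (coeff (i.length + 1) (lateSeries (b.length + s.length))) := by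
  obtain ⟨hx, hn'⟩ := List.nodup_cons.1 hn
  have hx' : x ∉ i := fun h => hx (List.mem_append_left _ h)
  have hn₁ : (i ++ (x :: b ++ s)).Nodup := List.perm_middle.nodup_iff.2 hn
  have h₁ := (hgen (b ++ s) hn').image_cons x
  have h₂ := hlate (b ++ [x]) s (by simp) (by
    refine List.Perm.nodup_iff (List.Perm.append_left i ?_) |>.1 hn₁
    simpa using List.perm_middle.symm)
  have h₃ := hlate [x] (b ++ s) (by simp) (by simpa using hn₁)
  rw [lateSeries_eq, coeff_succ_X_mul, map_add, map_add, add_assoc]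
  simp only [List.length_append, List.length_singleton] at h₁ h₂ h₃
  rw [show b.length + 1 + s.length = b.length + s.length + 1 by omega] at h₂
  rw [show 1 + (b.length + s.length) = b.length + s.length + 1 by omega] at h₃
  exact h₁.union (h₂.union h₃ (disjoint_lateOutputs_lateOutputs hb hn₁))
    (Disjoint.union_right (disjoint_cons_lateOutputs hx') (disjoint_cons_lateOutputs hx'))

theorem hasCard_inputFirstOutputs_cons {x : α} {i s : List α} (hn : (x :: i ++ s).Nodup)
    (hgen : HasCard {o | BlockGen i s o} (coeff i.length (outputSeries ^ (s.length + 1))))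
    (hlate : HasCard (lateOutputs i [x] s) (coeff i.length (lateSeries (s.length + 1)))) :
    HasCard (inputFirstOutputs (x :: i) s)
      (coeff (i.length + 1) (X * (outputSeries ^ (s.length + 1) + lateSeries (s.length + 1)))) := by
  have hx : x ∉ i := fun h => (List.nodup_cons.1 hn).1 (List.mem_append_left _ h)
  rw [coeff_succ_X_mul, map_add]
  exact (hgen.image_cons x).union hlate (disjoint_cons_lateOutputs hx)

/-- Outputting the top keeps the input and shortens the stack, hence an inner induction on the stack
for fixed input. -/
theorem hasCard_setOf_blockGen {i s : List α} (hn : (i ++ s).Nodup)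
    (h : ∀ s : List α, (i ++ s).Nodup → HasCard (inputFirstOutputs i s)
      (coeff i.length (X * (outputSeries ^ (s.length + 1) + lateSeries (s.length + 1))))) :
    HasCard {o | BlockGen i s o} (coeff i.length (outputSeries ^ (s.length + 1))) := by
  induction s with
  | nil =>
    cases i with
    | nil =>
      rw [setOf_blockGen_nil, List.length_nil, coeff_zero_outputSeries_pow]
      simp [HasCard]
    | cons x i =>
      rw [setOf_blockGen_eq_union (by simp), outputSeries_pow_succ, map_add]
      refine HasCard.union ?_ (h [] hn) (disjoint_stackFirstOutputs_inputFirstOutputs hn)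
      -- With an empty stack the term H^0 = 1 contributes nothing in positive degree.
      simpa [stackFirstOutputs, coeff_one] using HasCard.empty
  | cons a s ih =>
    rw [setOf_blockGen_eq_union (by simp), outputSeries_pow_succ, map_add]
    refine HasCard.union ?_ (h _ hn) (disjoint_stackFirstOutputs_inputFirstOutputs hn)
    refine HasCard.image_cons (ih ?_) a
    exact hn.sublist ((List.sublist_cons_self a s).append_left i)

theorem hasCard_outputs (i : List α) :
    (∀ s : List α, (i ++ s).Nodup →
      HasCard {o | BlockGen i s o} (coeff i.length (outputSeries ^ (s.length + 1)))) ∧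
    ∀ b s : List α, b ≠ [] → (i ++ (b ++ s)).Nodup →
      HasCard (lateOutputs i b s) (coeff i.length (lateSeries (b.length + s.length))) := by
  induction i with
  | nil =>
    refine ⟨fun s hs => hasCard_setOf_blockGen hs fun s _ => ?_, fun b s _ _ => ?_⟩
    · rw [List.length_nil, coeff_zero_X_mul]
      exact HasCard.empty
    · rw [List.length_nil, coeff_zero_lateSeries]
      exact HasCard.empty
  | cons x i ih =>
    refine ⟨fun s hs => hasCard_setOf_blockGen hs fun s hs => ?_, fun b s hb hn =>
      hasCard_lateOutputs_cons hb hn ih.1 ih.2⟩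
    refine hasCard_inputFirstOutputs_cons hs (ih.1 s (List.nodup_cons.1 hs).2) ?_
    have := ih.2 [x] s (by simp) (List.perm_middle.nodup_iff.2 hs)
    rwa [List.length_singleton, add_comm] at this

/-! ### From sortable permutations to generated lists -/

theorem psSortable_iff_blockGen {n : ℕ} (π : Equiv.Perm (Fin n)) :
    PSSortable π ↔ BlockGen (List.finRange n) [] (List.ofFn π.symm) := by
  rw [PSSortable, reachable_iff_blockGen]
  refine ⟨fun h => ?_, fun h => ?_⟩
  · simpa [List.ofFn_eq_map, Function.comp_def] using h.map π.symm
  · simpa [List.ofFn_eq_map, Function.comp_def] using h.map π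

theorem exists_perm_of_blockGen {n : ℕ} {o : List (Fin n)}
    (h : BlockGen (List.finRange n) [] o) : ∃ π : Equiv.Perm (Fin n), List.ofFn π = o := by
  have hp : o.Perm (List.finRange n) := by simpa using h.perm
  have hl : o.length = n := by simpa using hp.length_eq
  have hn : o.Nodup := hp.nodup_iff.2 (List.nodup_finRange n)
  have hinj : Function.Injective fun k : Fin n => o.get (k.cast hl.symm) := fun j k hjk => by
    simpa using hn.injective_get hjk
  refine ⟨Equiv.ofBijective _ (Finite.injective_iff_bijective.1 hinj), ?_⟩
  refine List.ext_get (by simp [hl]) fun k h₁ h₂ => ?_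
  simp

theorem psCount_eq_ncard (n : ℕ) :
    psCount n = {o : List (Fin n) | BlockGen (List.finRange n) [] o}.ncard := by
  have hf : Function.Injective fun π : Equiv.Perm (Fin n) => List.ofFn π.symm := fun π σ h =>
    Equiv.symm_bijective.injective (DFunLike.coe_injective (List.ofFn_injective h))
  have : {o : List (Fin n) | BlockGen (List.finRange n) [] o} =
      (fun π : Equiv.Perm (Fin n) => List.ofFn π.symm) '' {π | PSSortable π} := by
    ext o
    refine ⟨fun h => ?_, ?_⟩
    · obtain ⟨π, rfl⟩ := exists_perm_of_blockGen h
      exact ⟨π.symm, (psSortable_iff_blockGen _).2 h, rfl⟩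
    · rintro ⟨π, h, rfl⟩
      exact (psSortable_iff_blockGen π).1 h
  rw [this, Set.ncard_image_of_injective _ hf]
  rfl

theorem psCount_eq_oeisA033321 (n : ℕ) : (psCount n : ℚ) = oeisA033321 n := by
  rw [psCount_eq_ncard, ((hasCard_outputs (List.finRange n)).1 []
    (by simpa using List.nodup_finRange n)).2]
  simp [outputSeries]

theorem psGenFun_eq : psGenFun = outputSeries - 1 := by
  ext n
  cases n with
  | zero => simp [psGenFun, outputSeries, oeisA033321, fineNumber]
  | succ n => simp [psGenFun, outputSeries, psCount_eq_oeisA033321, coeff_one]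

end Counting

open PowerSeries in
theorem mainTheorem2 :
    (∃ s : PowerSeries ℚ,
      s ^ 2 = 1 - 6 * X + 5 * X ^ 2 ∧ constantCoeff s = 1 ∧
      (psGenFun : LaurentSeries ℚ) =
        ((1 - 3 * X + 2 * X ^ 2 - s : PowerSeries ℚ) : LaurentSeries ℚ) /
          ((2 * X * (2 - X) : PowerSeries ℚ) : LaurentSeries ℚ)) ∧
    ∀ n : ℕ, 1 ≤ n → (psCount n : ℚ) = oeisA033321 n := by
  -- The root is the series forced by the formula; its square is computed from the quadratic for H =
  -- 1 + `psGenFun`.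
  refine ⟨⟨1 - 3 * X + 2 * X ^ 2 - 2 * X * (2 - X) * psGenFun, ?_, ?_, ?_⟩,
    fun n _ => psCount_eq_oeisA033321 n⟩
  · have hq : X * (2 - X) * outputSeries ^ 2 - (1 + X) * outputSeries + 1 = 0 :=
      mk_oeisA033321_quadratic
    rw [psGenFun_eq]
    linear_combination 4 * X * (2 - X) * hq
  · simp
  · have hne : (2 * X * (2 - X) : PowerSeries ℚ) ≠ 0 := by
      have h2 : (2 : PowerSeries ℚ) ≠ 0 := fun h => by
        have := congrArg constantCoeff h
        rw [map_ofNat, map_zero] at this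
        norm_num at this
      refine mul_ne_zero (mul_ne_zero h2 X_ne_zero) fun h => ?_
      have := congrArg constantCoeff h
      rw [map_sub, map_ofNat, constantCoeff_X, map_zero] at this
      norm_num at this
    have hne' : ((2 * X * (2 - X) : PowerSeries ℚ) : LaurentSeries ℚ) ≠ 0 := by
      intro h
      exact hne (HahnSeries.ofPowerSeries_injective (h.trans (map_zero _).symm))
    rw [eq_div_iff hne', ← PowerSeries.coe_mul]
    congr 1
    ring
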